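/- Let $U$ be a Haar-random unitary on $\mathbb{C}^D$ and let the ideal QPUF be the quantum instrument $$\Lambda_U(\rho)=\sum_{i=0}^{D-1}|i\rangle\langle i|\otimes \Pi_i^U\rho\,\Pi_i^{U\dagger},\qquad \Pi_i^U=U|i\rangle\langle i|U^\dagger ,$$ i.e. the von Neumann measurement in the random basis $\{U|i\rangle\}$: on a pure input $|\psi\rangle$ it gives outcome $i$ with probability $\mathrm{Tr}[\Pi_i^U|\psi\rangle\langle\psi|]$ and leaves the state $U|i\rangle$. An adversary with private coins that are independent of $U$ queries $\Lambda_U$ on $n$ pure input states $|\psi_1\rangle,\dots,|\psi_n\rangle$; each input may depend (measurably) on the coins and on the earlier outcomes and post-measurement states. This gives the query database $Q_{\mathcal A}=\{(|\psi_i\rangle,q_i,U|q_i\rangle)\}$, with $|Q_{\mathcal A}|\le n$. For a target outcome $q$ the adversary then produces a pure state $|\psi_{\mathcal A}\rangle$ that depends (measurably) on its coins and on the database, and it passes verification for $q$ with probability $P_q=\mathrm{Tr}[\Pi_q^U|\psi_{\mathcal A}\rangle\langle\psi_{\mathcal A}|]$. Write $q\notin Q_{\mathcal A}$ if $q$ is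 none of the outcomes $q_i$. (1) For every $D$, every such adversary and every $q$: almost surely, if $q\notin Q_{\mathcal A}$ and $|Q_{\mathcal A}|<D$, then the conditional expectation of $P_q$ given the coins and the database satisfies $$E[P_q\mid \text{coins},\,Q_{\mathcal A}]\le \frac{1}{D-|Q_{\mathcal A}|}.$$ Moreover, if $n<D$, then $E[P_q\mid q\notin Q_{\mathcal A}]\le \frac1{D-n}$ (nothing is claimed if the event $q\notin Q_{\mathcal A}$ has probability $0$). (2) Let $D=2^\lambda$. For every polynomial $p$ there is a negligible function $\varepsilon$ (with $\varepsilon(\lambda)=O(b^{-\lambda})$ for some $b>1$) such that for all $\lambda$, every adversary and every $q$: almost surely, if $q\notin Q_{\mathcal A}$ and $|Q_{\mathcal A}|\le p(\lambda)$, then $E[P_q\mid \text{coins},\,Q_{\mathcal A}]\le\varepsilon(\lambda)$; and if the adversary makes $n\le p(\lambda)$ queries, then $E[P_q\mid q\notin Q_{\mathcal A}]\le\varepsilon(\lambda)$. That is, the ideal QPUF is existentially unforgeable. -/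

import Mathlib

open MeasureTheory ProbabilityTheory
open scoped Kronecker ENNReal

namespace QPUF

section Quantum

/-- The unitary group `U(D)`. -/
abbrev UGroup (D : ℕ) : Type := Matrix.unitaryGroup (Fin D) ℂ

noncomputable instance (D : ℕ) : MeasurableSpace (UGroup D) := borel _

instance (D : ℕ) : BorelSpace (UGroup D) := ⟨rfl⟩

instance (D : ℕ) : CompactSpace (UGroup D) := by
  refine isCompact_iff_compactSpace.mp ?_
  have hK : IsCompact (Set.pi Set.univ fun _ : Fin D => Set.pi Set.univ fun _ : Fin D =>
      Metric.closedBall (0 : ℂ) 1) :=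
    isCompact_univ_pi fun _ => isCompact_univ_pi fun _ => isCompact_closedBall _ _
  refine IsCompact.of_isClosed_subset (show IsCompact (X := Matrix (Fin D) (Fin D) ℂ) _ from hK)
    ?_ ?_
  · have : (Matrix.unitaryGroup (Fin D) ℂ : Set (Matrix (Fin D) (Fin D) ℂ))
        = {A | A * star A = 1} := by
      ext A; exact Matrix.mem_unitaryGroup_iff
    rw [this]
    exact isClosed_eq (by fun_prop) continuous_const
  · intro A hA i _ j _
    simpa using entry_norm_bound_of_unitary hA i j

/-- The Haar probability measure on `U(D)`. -/
noncomputable def haarU (D : ℕ) : Measure (UGroup D) :=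
  Measure.haarMeasure (⊤ : TopologicalSpace.PositiveCompacts (UGroup D))

instance (D : ℕ) : IsProbabilityMeasure (haarU D) := ⟨Measure.haarMeasure_self⟩

/-- Pure states (unit vectors) of `ℂ^D`. -/
abbrev PureState (D : ℕ) : Type := Metric.sphere (0 : EuclideanSpace ℂ (Fin D)) 1

/-- The density matrix `|ψ⟩⟨ψ|`. -/
def density {D : ℕ} (ψ : PureState D) : Matrix (Fin D) (Fin D) ℂ :=
  Matrix.vecMulVec ψ.1.ofLp (star ψ.1.ofLp)

/-- The projector `Π_i^U = U |i⟩⟨i| U†`. -/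
def proj {D : ℕ} (U : UGroup D) (i : Fin D) : Matrix (Fin D) (Fin D) ℂ :=
  U.1 * Matrix.single i i 1 * U.1.conjTranspose

/-- The ideal QPUF: the quantum instrument `Λ_U(ρ) = ∑ i, |i⟩⟨i| ⊗ Π_i^U ρ (Π_i^U)†`. -/
def instrument {D : ℕ} (U : UGroup D) (ρ : Matrix (Fin D) (Fin D) ℂ) :
    Matrix (Fin D × Fin D) (Fin D × Fin D) ℂ :=
  ∑ i, Matrix.single i i (1 : ℂ) ⊗ₖ (proj U i * ρ * (proj U i).conjTranspose)

/-- The probability `Tr[Π_i^U |ψ⟩⟨ψ|]` that `Λ_U` gives outcome `i` on input `|ψ⟩`. -/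
def outcomeProb {D : ℕ} (U : UGroup D) (i : Fin D) (ψ : PureState D) : ℝ :=
  (Matrix.trace (proj U i * density ψ)).re

/-- The post-measurement state `U|i⟩` belonging to outcome `i`. -/
def token {D : ℕ} (U : UGroup D) (i : Fin D) : PureState D :=
  ⟨WithLp.toLp 2 (U.1.mulVec (Pi.single i 1)), by
    have h : (star U.1 * U.1) i i = 1 := by
      rw [Matrix.mem_unitaryGroup_iff'.mp U.2]; simp
    rw [Matrix.mul_apply] at h
    simp only [mem_sphere_iff_norm, sub_zero, EuclideanSpace.norm_eq, Real.sqrt_eq_one]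
    have h2 := congrArg Complex.re h
    simpa [Matrix.star_apply, ← Complex.normSq_eq_conj_mul_self, Complex.normSq_eq_norm_sq,
      ← Complex.ofReal_pow] using h2⟩

theorem proj_eq {D : ℕ} (U : UGroup D) (i : Fin D) : proj U i = density (token U i) := by
  ext a b
  simp [proj, density, token, Matrix.vecMulVec_apply, Matrix.mul_apply, Matrix.single_apply,
    Finset.sum_ite_eq, ite_and]

theorem trace_eq {D : ℕ} (U : UGroup D) (i : Fin D) (ψ : PureState D) :
    Matrix.trace (proj U i * density ψ) =
      (Complex.normSq (star (token U i).1.ofLp ⬝ᵥ ψ.1.ofLp) : ℂ) := by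
  rw [proj_eq, density, density, Matrix.vecMulVec_mul_vecMulVec, Matrix.vecMulVec_smul,
    Matrix.trace_smul, Matrix.trace_vecMulVec, Complex.normSq_eq_conj_mul_self, smul_eq_mul, mul_comm]
  congr 1
  simp [dotProduct, mul_comm]

theorem outcomeProb_eq {D : ℕ} (U : UGroup D) (i : Fin D) (ψ : PureState D) :
    outcomeProb U i ψ = Complex.normSq (star (token U i).1.ofLp ⬝ᵥ ψ.1.ofLp) := by
  rw [outcomeProb, trace_eq, Complex.ofReal_re]

/-- On a pure input, `Λ_U` gives outcome `i` and leaves the state `U|i⟩`, with probability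
`outcomeProb U i ψ`. -/
theorem instrument_density {D : ℕ} (U : UGroup D) (ψ : PureState D) :
    instrument U (density ψ) =
      ∑ i, (outcomeProb U i ψ : ℂ) • (Matrix.single i i (1 : ℂ) ⊗ₖ density (token U i)) := by
  refine Finset.sum_congr rfl fun i _ => ?_
  rw [← Matrix.kronecker_smul]
  congr 1
  rw [proj_eq, outcomeProb_eq, Complex.normSq_eq_conj_mul_self]
  ext a b
  simp only [density, Matrix.conjTranspose_vecMulVec, star_star, Matrix.vecMulVec_mul_vecMulVec,
    Matrix.smul_apply, Matrix.vecMulVec_apply, smul_eq_mul, Matrix.smul_mul,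
    Matrix.vecMulVec_smul]
  have : (starRingEnd ℂ) (star (token U i).1.ofLp ⬝ᵥ ψ.1.ofLp)
      = star ψ.1.ofLp ⬝ᵥ (token U i).1.ofLp := by
    simp [dotProduct, mul_comm]
  rw [this]
  ring

theorem sum_outcomeProb {D : ℕ} (U : UGroup D) (ψ : PureState D) :
    ∑ i, outcomeProb U i ψ = 1 := by
  have h1 : ∑ i, proj U i = 1 := by
    simp only [proj, ← Finset.sum_mul, ← Finset.mul_sum]
    have : ∑ i : Fin D, Matrix.single i i (1 : ℂ) = 1 := by
      rw [Matrix.sum_single_one]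
    rw [this, mul_one]
    exact Matrix.mem_unitaryGroup_iff.mp U.2
  have h2 : ‖ψ.1‖ ^ 2 = 1 := by rw [norm_eq_of_mem_sphere]; norm_num
  rw [EuclideanSpace.norm_sq_eq] at h2
  simp only [outcomeProb, ← Complex.re_sum, ← Matrix.trace_sum, ← Finset.sum_mul, h1, one_mul]
  rw [density, Matrix.trace_vecMulVec, dotProduct, Complex.re_sum]
  refine Eq.trans ?_ h2
  refine Finset.sum_congr rfl fun i _ => ?_
  simp [Complex.mul_conj, ← Complex.normSq_eq_norm_sq, Complex.normSq_apply]

theorem outcomeProb_nonneg {D : ℕ} (U : UGroup D) (i : Fin D) (ψ : PureState D) :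
    0 ≤ outcomeProb U i ψ := by
  rw [outcomeProb_eq]; exact Complex.normSq_nonneg _

theorem continuous_token {D : ℕ} (i : Fin D) : Continuous fun U : UGroup D => token U i := by
  unfold token
  fun_prop

theorem continuous_outcomeProb {D : ℕ} (i : Fin D) :
    Continuous fun p : UGroup D × PureState D => outcomeProb p.1 i p.2 := by
  unfold outcomeProb proj density
  fun_prop

end Quantum

section Game

/-- An entry `(|ψ⟩, q, U|q⟩)` of a query database. -/
abbrev Entry (D : ℕ) : Type := PureState D × Fin D × PureState D

/-- An adversary that makes `n` queries and has private coins in `Ω`. Its queries may be adaptive: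
the input of query `i` may depend on the coins and on all earlier outcomes and post-measurement
states (the earlier inputs are functions of these). After the queries it produces, for a target
outcome, a pure state that may depend on the coins and on everything in its database. -/
structure Adversary (Ω : Type*) [MeasurableSpace Ω] (D n : ℕ) where
  query : (i : Fin n) → Ω × (Fin i → Fin D × PureState D) → PureState D
  measurable_query : ∀ i, Measurable (query i)
  forge : Fin D → Ω × (Fin n → Entry D) → PureState D
  measurable_forge : ∀ q, Measurable (forge q)

/-- A run of the query phase: the unitary of the device, the adversary's coins, and the
measurement outcomes of the `n` queries. -/
abbrev Run (Ω : Type*) (D n : ℕ) : Type _ := UGroup D × Ω × (Fin n → Fin D)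

namespace Adversary

variable {Ω : Type*} [MeasurableSpace Ω] {D n : ℕ}

/-- The input state of query `i`. -/
def input (A : Adversary Ω D n) (x : Run Ω D n) (i : Fin n) : PureState D :=
  A.query i (x.2.1, fun j => (x.2.2 (Fin.castLE i.2.le j), token x.1 (x.2.2 (Fin.castLE i.2.le j))))

/-- The `i`-th entry `(|ψ_i⟩, q_i, U|q_i⟩)` of the query database. -/
def entry (A : Adversary Ω D n) (x : Run Ω D n) (i : Fin n) : Entry D :=
  (A.input x i, x.2.2 i, token x.1 (x.2.2 i))

/-- The query database `Q_A`, as a set of triples. -/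
def database (A : Adversary Ω D n) (x : Run Ω D n) : Set (Entry D) := Set.range (A.entry x)

/-- `q ∉ Q_A`: no entry of the database has the outcome `q`. -/
def Fresh (A : Adversary Ω D n) (q : Fin D) (x : Run Ω D n) : Prop :=
  ∀ e ∈ A.database x, e.2.1 ≠ q

/-- What the adversary knows after the queries: its coins and the entries of its database. -/
def view (A : Adversary Ω D n) (x : Run Ω D n) : Ω × (Fin n → Entry D) := (x.2.1, A.entry x)

/-- The passing probability `P_q = Tr[Π_q^U |ψ_A⟩⟨ψ_A|]` of the adversary's guess state. -/
def passProb (A : Adversary Ω D n) (q : Fin D) (x : Run Ω D n) : ℝ :=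
  outcomeProb x.1 q (A.forge q (A.view x))

/-- The probability, given the unitary and the coins, of the outcomes of the run: the product of the
outcome probabilities of the successive queries. -/
def weight (A : Adversary Ω D n) (x : Run Ω D n) : ℝ :=
  ∏ i, outcomeProb x.1 (x.2.2 i) (A.input x i)

/-- The joint law of a Haar random unitary, independent coins with law `ν`, and the outcomes of the
queries to `Λ_U`. -/
noncomputable def law (A : Adversary Ω D n) (ν : Measure Ω) : Measure (Run Ω D n) :=
  ((haarU D).prod (ν.prod Measure.count)).withDensity fun x => ENNReal.ofReal (A.weight x)

theorem measurable_token : Measurable fun p : UGroup D × Fin D => token p.1 p.2 :=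
  measurable_from_prod_countable_left fun i => (continuous_token i).measurable

theorem measurable_outcomeProb :
    Measurable fun p : (UGroup D × PureState D) × Fin D => outcomeProb p.1.1 p.2 p.1.2 :=
  measurable_from_prod_countable_left fun i => (continuous_outcomeProb i).measurable

theorem measurable_input (A : Adversary Ω D n) (i : Fin n) : Measurable fun x => A.input x i := by
  unfold input
  refine (A.measurable_query i).comp (Measurable.prodMk (by fun_prop) ?_)
  refine measurable_pi_lambda _ fun j => Measurable.prodMk (by fun_prop) ?_
  exact measurable_token.comp (Measurable.prodMk (by fun_prop) (by fun_prop))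

theorem measurable_weight (A : Adversary Ω D n) : Measurable A.weight := by
  have h : ∀ i, Measurable fun x : Run Ω D n => outcomeProb x.1 (x.2.2 i) (A.input x i) := by
    intro i
    have h1 : Measurable fun x : Run Ω D n => ((x.1, A.input x i), x.2.2 i) :=
      (measurable_fst.prodMk (A.measurable_input i)).prodMk
        ((measurable_pi_apply i).comp (measurable_snd.comp measurable_snd))
    have h2 := measurable_outcomeProb.comp h1
    exact h2
  exact Finset.measurable_fun_prod _ fun i _ => h i

theorem weight_nonneg (A : Adversary Ω D n) (x : Run Ω D n) : 0 ≤ A.weight x :=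
  Finset.prod_nonneg fun _ _ => outcomeProb_nonneg _ _ _

theorem sum_prod_eq_one {D : ℕ} : ∀ (n : ℕ) (f : (i : Fin n) → (Fin i → Fin D) → Fin D → ℝ),
    (∀ i h, ∑ a, f i h a = 1) →
    ∑ r : Fin n → Fin D, ∏ i, f i (fun j => r (Fin.castLE i.2.le j)) (r i) = 1
  | 0, f, _ => by simp
  | n + 1, f, hf => by
    rw [← (Fin.snocEquiv fun _ : Fin (n + 1) => Fin D).sum_comp, Fintype.sum_prod_type,
      Finset.sum_comm, ← sum_prod_eq_one n (fun i h => f i.castSucc h) fun i h => hf _ _]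
    refine Finset.sum_congr rfl fun r _ => ?_
    simp only [Fin.prod_univ_castSucc, Fin.snocEquiv, Equiv.coe_fn_mk, Fin.snoc_castSucc,
      Fin.snoc_last]
    have h1 : ∀ (a : Fin D) (j : Fin n),
        @Fin.snoc n (fun _ => Fin D) r a (Fin.castLE (Fin.last n).2.le j) = r j := fun a j =>
      Fin.snoc_castSucc (α := fun _ => Fin D) a r j
    have h2 : ∀ (a : Fin D) (i : Fin n) (j : Fin i.castSucc),
        @Fin.snoc n (fun _ => Fin D) r a (Fin.castLE i.castSucc.2.le j)
          = r (Fin.castLE i.2.le j) := fun a i j =>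
      Fin.snoc_castSucc (α := fun _ => Fin D) a r (Fin.castLE i.2.le j)
    simp only [h2]
    rw [← Finset.mul_sum]
    refine (mul_right_eq_self₀.mpr (Or.inl ?_))
    have := hf (Fin.last n) r
    rw [← this]
    refine Finset.sum_congr rfl fun a _ => ?_
    congr 1
    funext j
    exact h1 a j

theorem sum_weight (A : Adversary Ω D n) (U : UGroup D) (ω : Ω) :
    ∑ r : Fin n → Fin D, A.weight (U, ω, r) = 1 :=
  sum_prod_eq_one n
    (fun i h a => outcomeProb U a (A.query i (ω, fun j => (h j, token U (h j)))))
    fun _ _ => sum_outcomeProb _ _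

instance (A : Adversary Ω D n) (ν : Measure Ω) [IsProbabilityMeasure ν] :
    IsProbabilityMeasure (A.law ν) := by
  constructor
  have hm : Measurable fun x => ENNReal.ofReal (A.weight x) := A.measurable_weight.ennreal_ofReal
  rw [law, withDensity_apply _ MeasurableSet.univ, Measure.restrict_univ,
    lintegral_prod _ hm.aemeasurable]
  have h : ∀ U : UGroup D,
      ∫⁻ y, ENNReal.ofReal (A.weight (U, y)) ∂(ν.prod Measure.count) = 1 := fun U => by
    have hU : Measurable fun y : Ω × (Fin n → Fin D) => ENNReal.ofReal (A.weight (U, y)) :=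
      hm.comp measurable_prodMk_left
    rw [lintegral_prod _ hU.aemeasurable]
    have : ∀ ω, ∫⁻ r, ENNReal.ofReal (A.weight (U, ω, r)) ∂Measure.count = 1 := fun ω => by
      rw [lintegral_count, tsum_fintype, ← ENNReal.ofReal_sum_of_nonneg fun r _ =>
        A.weight_nonneg _, sum_weight, ENNReal.ofReal_one]
    simp [this]
  simp [h]

/-- The expected passing probability for `q` given everything the adversary knows after its queries,
in particular given the database `Q_A`. -/
noncomputable def expPassGivenView (A : Adversary Ω D n) (ν : Measure Ω) (q : Fin D) :
    Run Ω D n → ℝ :=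
  condExp (MeasurableSpace.comap A.view inferInstance) (A.law ν) (A.passProb q)

/-- The expected passing probability for `q` given the event `q ∉ Q_A`. -/
noncomputable def expPass (A : Adversary Ω D n) (ν : Measure Ω) (q : Fin D) : ℝ :=
  ∫ x, A.passProb q x ∂(cond (A.law ν) {x | A.Fresh q x})

end Adversary

/-- Negligible functions: exponential decay to `0`. In particular such a function decays faster than
the inverse of every polynomial. -/
def IsNegligible (ε : ℕ → ℝ) : Prop :=
  ∃ b : ℝ, 1 < b ∧ ε =O[Filter.atTop] fun k => (b ^ k)⁻¹

end Game

end QPUF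

namespace QPUF

/-! Once coins and outcomes are fixed, everything the adversary knows, and the likelihood of the
run, depends on `U` only through the observed columns. Right multiplication by a transposition of
two unobserved columns preserves Haar measure and all this data, but exchanges the passing
probabilities of the two outcomes. Hence all unobserved outcomes have the same average passing
probability; their probabilities sum to at most 1, so each average is at most 1/(D - s), with s the
number of distinct outcomes seen. This is `lintegral_outcomeProb_le`.

`setLIntegral_passProb_le` transfers the bound to every fresh event visible to the adversary, by
integrating over `U` first. Testing on all such events gives the conditional expectation bound; the
event of freshness alone gives the bound for `expPass`. Negligibility follows because a polynomial
is o(2^k). -/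

/-! ### Haar symmetry under permutations of the basis -/

instance (D : ℕ) : (haarU D).IsHaarMeasure := by
  unfold haarU
  infer_instance

/-- A right translate of Haar measure is again a Haar probability measure, and such a measure is
unique. -/
instance (D : ℕ) : (haarU D).IsMulRightInvariant where
  map_mul_right_eq_self g := by
    have : IsProbabilityMeasure ((haarU D).map (· * g)) :=
      Measure.isProbabilityMeasure_map (measurable_mul_const g).aemeasurable
    exact Measure.isHaarMeasure_eq_of_isProbabilityMeasure _ _

/-- The unitary that permutes the standard basis. -/
def permUnitary {D : ℕ} (σ : Equiv.Perm (Fin D)) : UGroup D :=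
  -- `permMatrix` of σ has its ones at (i, σ i); the inverse is taken so that column i is the basis
  -- vector at σ i.
  ⟨(σ⁻¹).permMatrix ℂ, by
    rw [Matrix.mem_unitaryGroup_iff, Matrix.star_eq_conjTranspose, Matrix.conjTranspose_permMatrix,
      ← Matrix.permMatrix_mul]
    simp⟩

theorem token_mul_permUnitary {D : ℕ} (U : UGroup D) (σ : Equiv.Perm (Fin D)) (i : Fin D) :
    token (U * permUnitary σ) i = token U (σ i) := by
  apply Subtype.ext
  simp only [token, permUnitary, Submonoid.coe_mul, ← Matrix.mulVec_mulVec]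
  congr 2
  ext j
  simp [Pi.single_apply, Equiv.symm_apply_eq]

theorem outcomeProb_congr {D : ℕ} {U V : UGroup D} {i j : Fin D} (h : token U i = token V j)
    (ψ : PureState D) : outcomeProb U i ψ = outcomeProb V j ψ := by
  rw [outcomeProb_eq, outcomeProb_eq, h]

theorem outcomeProb_le_one {D : ℕ} (U : UGroup D) (i : Fin D) (ψ : PureState D) :
    outcomeProb U i ψ ≤ 1 := by
  rw [← sum_outcomeProb U ψ]
  exact Finset.single_le_sum (fun j _ => outcomeProb_nonneg U j ψ) (Finset.mem_univ i)

/-- If a weight `h` and a state `ψ` depend on a Haar random unitary only through the columns in `S`,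
then all outcomes outside `S` have the same weighted probability for `ψ`, so that each of them takes
at most a fraction `1 / (D - #S)` of the total weight. -/
theorem lintegral_outcomeProb_le {D : ℕ} (S : Finset (Fin D)) {q : Fin D} (hq : q ∉ S)
    {h : UGroup D → ℝ≥0∞} {ψ : UGroup D → PureState D} (hm : Measurable h) (ψm : Measurable ψ)
    (hh : ∀ U V : UGroup D, (∀ i ∈ S, token U i = token V i) → h U = h V)
    (hψ : ∀ U V : UGroup D, (∀ i ∈ S, token U i = token V i) → ψ U = ψ V) :
    ∫⁻ U, h U * ENNReal.ofReal (outcomeProb U q (ψ U)) ∂haarU D ≤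
      ∫⁻ U, h U * ENNReal.ofReal (1 / ((D : ℝ) - S.card)) ∂haarU D := by
  have hlt : S.card < D := by
    simpa using Finset.card_lt_univ_of_notMem hq
  have hsymm : ∀ q' ∈ Sᶜ, ∫⁻ U, h U * ENNReal.ofReal (outcomeProb U q' (ψ U)) ∂haarU D =
      ∫⁻ U, h U * ENNReal.ofReal (outcomeProb U q (ψ U)) ∂haarU D := by
    intro q' hq'
    rw [Finset.mem_compl] at hq'
    -- The swap moves only columns outside `S`, so `h` and `ψ` do not notice this change of
    -- variables.
    rw [← lintegral_mul_right_eq_self _ (permUnitary (Equiv.swap q q'))]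
    refine lintegral_congr fun U => ?_
    have hfix : ∀ i ∈ S, token (U * permUnitary (Equiv.swap q q')) i = token U i := by
      intro i hi
      rw [token_mul_permUnitary, Equiv.swap_apply_of_ne_of_ne] <;> rintro rfl <;> contradiction
    rw [hh _ _ hfix, hψ _ _ hfix]
    rw [outcomeProb_congr (V := U) (j := q)]
    rw [token_mul_permUnitary, Equiv.swap_apply_right]
  have hmeas : ∀ i, Measurable fun U => h U * ENNReal.ofReal (outcomeProb U i (ψ U)) := fun i =>
    hm.mul ((continuous_outcomeProb i).measurable.comp (measurable_id.prodMk ψm)).ennreal_ofReal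
  have hsum : ((D - S.card : ℕ) : ℝ≥0∞) *
      ∫⁻ U, h U * ENNReal.ofReal (outcomeProb U q (ψ U)) ∂haarU D ≤ ∫⁻ U, h U ∂haarU D := by
    calc _ = ∑ q' ∈ Sᶜ, ∫⁻ U, h U * ENNReal.ofReal (outcomeProb U q' (ψ U)) ∂haarU D := by
          rw [Finset.sum_congr rfl hsymm, Finset.sum_const, Finset.card_compl, Fintype.card_fin,
            nsmul_eq_mul]
      _ = ∫⁻ U, h U * ENNReal.ofReal (∑ q' ∈ Sᶜ, outcomeProb U q' (ψ U)) ∂haarU D := by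
          rw [← lintegral_finsetSum _ fun i _ => hmeas i]
          refine lintegral_congr fun U => ?_
          rw [← Finset.mul_sum, ENNReal.ofReal_sum_of_nonneg fun _ _ => outcomeProb_nonneg _ _ _]
      _ ≤ ∫⁻ U, h U ∂haarU D := by
          refine lintegral_mono fun U => mul_le_of_le_one_right' ?_
          rw [ENNReal.ofReal_le_one, ← sum_outcomeProb U (ψ U)]
          exact Finset.sum_le_sum_of_subset_of_nonneg (Finset.subset_univ _)
            fun _ _ _ => outcomeProb_nonneg _ _ _
  rw [lintegral_mul_const _ hm, one_div, ← Nat.cast_sub hlt.le,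
    ENNReal.ofReal_inv_of_pos (by exact_mod_cast Nat.sub_pos_of_lt hlt), ENNReal.ofReal_natCast,
    ← div_eq_mul_inv, ENNReal.le_div_iff_mul_le (Or.inl (by exact_mod_cast Nat.sub_ne_zero_of_lt hlt))
      (by simp), mul_comm]
  exact hsum

/-! ### The bound as a function of the adversary's view -/

namespace Adversary

variable {Ω : Type*} {D n : ℕ}

/-- The set of outcomes of a run. -/
def outcomes (r : Fin n → Fin D) : Finset (Fin D) := Finset.univ.image r

/-- The bound `1 / (D - s)`, where `s` is the number of distinct outcomes of the run. -/
noncomputable def freshBound (x : Run Ω D n) : ℝ := 1 / ((D : ℝ) - (outcomes x.2.2).card)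

theorem card_outcomes_le (r : Fin n → Fin D) : (outcomes r).card ≤ n := by
  simpa [outcomes] using Finset.card_image_le (s := Finset.univ) (f := r)

theorem freshBound_nonneg (x : Run Ω D n) : 0 ≤ freshBound x := by
  have : (outcomes x.2.2).card ≤ D := by simpa using Finset.card_le_univ (outcomes x.2.2)
  exact one_div_nonneg.mpr (sub_nonneg.mpr (by exact_mod_cast this))

theorem freshBound_le {x : Run Ω D n} {m : ℕ} (h : (outcomes x.2.2).card ≤ m) (hm : m < D) :
    freshBound x ≤ 1 / ((D : ℝ) - m) := by
  have h1 : ((outcomes x.2.2).card : ℝ) ≤ m := by exact_mod_cast h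
  have h2 : (m : ℝ) < D := by exact_mod_cast hm
  exact one_div_le_one_div_of_le (by linarith) (by linarith)

/-- The denominator is a natural number; if all D outcomes occurred, it is 0 and the convention 1/0
= 0 applies. -/
theorem freshBound_le_one (x : Run Ω D n) : freshBound x ≤ 1 := by
  have h : (outcomes x.2.2).card ≤ D := by simpa using Finset.card_le_univ (outcomes x.2.2)
  rw [freshBound, ← Nat.cast_sub h, one_div]
  exact Nat.cast_inv_le_one _

variable [MeasurableSpace Ω]

theorem fresh_iff (A : Adversary Ω D n) (q : Fin D) (x : Run Ω D n) :
    A.Fresh q x ↔ q ∉ outcomes x.2.2 := by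
  simp [Fresh, database, entry, outcomes]

/-- One outcome may occur in several triples with different inputs, so counting distinct outcomes
gives the sharper bound. -/
theorem card_outcomes_le_ncard (A : Adversary Ω D n) (x : Run Ω D n) :
    (outcomes x.2.2).card ≤ (A.database x).ncard := by
  have h : (outcomes x.2.2 : Set (Fin D)) = (fun e : Entry D => e.2.1) '' A.database x := by
    ext a
    simp [outcomes, database, entry]
  rw [← Set.ncard_coe_finset, h]
  exact Set.ncard_image_le (Set.finite_range _)

theorem measurable_entry (A : Adversary Ω D n) : Measurable A.entry := by
  refine measurable_pi_lambda _ fun i => (A.measurable_input i).prodMk ?_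
  refine Measurable.prodMk (by fun_prop) ?_
  exact measurable_token.comp (Measurable.prodMk (by fun_prop) (by fun_prop))

theorem measurable_view (A : Adversary Ω D n) : Measurable A.view :=
  Measurable.prodMk (by fun_prop) A.measurable_entry

theorem measurable_passProb (A : Adversary Ω D n) (q : Fin D) : Measurable (A.passProb q) := by
  have h : Measurable fun x : Run Ω D n => ((x.1, A.forge q (A.view x)), q) :=
    (measurable_fst.prodMk ((A.measurable_forge q).comp A.measurable_view)).prodMk measurable_const
  have h' := measurable_outcomeProb.comp h
  exact h'

theorem integrable_passProb (A : Adversary Ω D n) (ν : Measure Ω) [IsProbabilityMeasure ν]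
    (q : Fin D) : Integrable (A.passProb q) (A.law ν) := by
  refine Integrable.of_bound (A.measurable_passProb q).aestronglyMeasurable 1
    (ae_of_all _ fun x => ?_)
  rw [passProb, Real.norm_of_nonneg (outcomeProb_nonneg _ _ _)]
  exact outcomeProb_le_one _ _ _

/-- `freshBound` is a function of what the adversary knows. -/
theorem measurable_comap_freshBound (A : Adversary Ω D n) :
    Measurable[MeasurableSpace.comap A.view inferInstance] (freshBound : Run Ω D n → ℝ) := by
  have h : (freshBound : Run Ω D n → ℝ) =
      (fun r : Fin n → Fin D => 1 / ((D : ℝ) - (outcomes r).card)) ∘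
        (fun v : Ω × (Fin n → Entry D) => fun i => (v.2 i).2.1) ∘ A.view := rfl
  rw [h]
  exact (measurable_of_finite _).comp
    (Measurable.comp (by fun_prop) (comap_measurable A.view))

theorem measurableSet_comap_fresh (A : Adversary Ω D n) (q : Fin D) :
    MeasurableSet[MeasurableSpace.comap A.view inferInstance] {x | A.Fresh q x} := by
  refine ⟨(fun v : Ω × (Fin n → Entry D) => fun i => (v.2 i).2.1) ⁻¹' {r | q ∉ outcomes r},
    ?_, ?_⟩
  · exact (show Measurable fun v : Ω × (Fin n → Entry D) => fun i => (v.2 i).2.1 by fun_prop)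
      (Set.toFinite _).measurableSet
  · ext x
    exact (A.fresh_iff q x).symm

/-! ### Averaging over the unobserved columns -/

theorem input_congr (A : Adversary Ω D n) {U V : UGroup D} {ω : Ω} {r : Fin n → Fin D}
    (h : ∀ i ∈ outcomes r, token U i = token V i) (i : Fin n) :
    A.input (U, ω, r) i = A.input (V, ω, r) i := by
  have h' : ∀ j, token U (r j) = token V (r j) := fun j => h _ (by simp [outcomes])
  simp [input, h']

theorem view_congr (A : Adversary Ω D n) {U V : UGroup D} {ω : Ω} {r : Fin n → Fin D}
    (h : ∀ i ∈ outcomes r, token U i = token V i) :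
    A.view (U, ω, r) = A.view (V, ω, r) := by
  have h' : ∀ j, token U (r j) = token V (r j) := fun j => h _ (by simp [outcomes])
  refine Prod.ext rfl (funext fun i => ?_)
  simp [view, entry, A.input_congr h, h']

theorem weight_congr (A : Adversary Ω D n) {U V : UGroup D} {ω : Ω} {r : Fin n → Fin D}
    (h : ∀ i ∈ outcomes r, token U i = token V i) :
    A.weight (U, ω, r) = A.weight (V, ω, r) := by
  refine Finset.prod_congr rfl fun i _ => ?_
  simp only [A.input_congr h]
  exact outcomeProb_congr (h _ (by simp [outcomes])) _

/-- On every event that the adversary can recognize and that forces `q ∉ Q_A`, the passing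
probability is on average at most `freshBound`. -/
theorem setLIntegral_passProb_le (A : Adversary Ω D n) (ν : Measure Ω) [IsProbabilityMeasure ν]
    {q : Fin D} {s : Set (Run Ω D n)}
    (hs : MeasurableSet[MeasurableSpace.comap A.view inferInstance] s)
    (hsq : ∀ x ∈ s, A.Fresh q x) :
    ∫⁻ x in s, ENNReal.ofReal (A.passProb q x) ∂A.law ν ≤
      ∫⁻ x in s, ENNReal.ofReal (freshBound x) ∂A.law ν := by
  have hle : MeasurableSpace.comap A.view inferInstance ≤
    (inferInstance : MeasurableSpace (Run Ω D n)) := A.measurable_view.comap_le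
  have hs' := hle _ hs
  have hw : Measurable fun x => ENNReal.ofReal (A.weight x) := A.measurable_weight.ennreal_ofReal
  have hp := (A.measurable_passProb q).ennreal_ofReal
  have hb : Measurable fun x : Run Ω D n => ENNReal.ofReal (freshBound x) :=
    (A.measurable_comap_freshBound.mono hle le_rfl).ennreal_ofReal
  have hh : Measurable (s.indicator fun x => ENNReal.ofReal (A.weight x)) := hw.indicator hs'
  -- Tonelli with `U` innermost: coins and outcomes are frozen, so the set of observed columns is
  -- constant in the inner integral.
  have key : ∀ f : Run Ω D n → ℝ≥0∞, Measurable f → ∫⁻ x in s, f x ∂A.law ν =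
      ∫⁻ y, ∫⁻ U, s.indicator (fun x => ENNReal.ofReal (A.weight x)) (U, y) * f (U, y)
        ∂haarU D ∂(ν.prod Measure.count) := by
    intro f hf
    rw [← lintegral_indicator hs', law, lintegral_withDensity_eq_lintegral_mul _ hw
      (hf.indicator hs')]
    refine Eq.trans ?_ (lintegral_prod_symm' _ (hh.mul hf))
    refine lintegral_congr fun x => ?_
    by_cases hx : x ∈ s <;> simp [hx]
  rw [key _ hp, key _ hb]
  refine lintegral_mono fun y => ?_
  obtain ⟨ω, r⟩ := y
  -- As a preimage under `view`, the event too depends on `U` only through the observed columns.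
  obtain ⟨B, -, rfl⟩ := hs
  by_cases hq : q ∈ outcomes r
  · refine le_of_eq_of_le (lintegral_eq_zero_of_ae_eq_zero (ae_of_all _ fun U => ?_)) zero_le
    have : (U, ω, r) ∉ A.view ⁻¹' B := fun hU => (A.fresh_iff q _).mp (hsq _ hU) hq
    simp [this]
  · refine lintegral_outcomeProb_le (outcomes r) hq
      (h := fun U => (A.view ⁻¹' B).indicator (fun x => ENNReal.ofReal (A.weight x)) (U, ω, r))
      (ψ := fun U => A.forge q (A.view (U, ω, r)))
      (hh.comp measurable_prodMk_right)
      ((A.measurable_forge q).comp (A.measurable_view.comp measurable_prodMk_right)) ?_ ?_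
    · intro U V hUV
      have hmem : (U, ω, r) ∈ A.view ⁻¹' B ↔ (V, ω, r) ∈ A.view ⁻¹' B := by
        rw [Set.mem_preimage, Set.mem_preimage, A.view_congr hUV]
      by_cases hU : (U, ω, r) ∈ A.view ⁻¹' B
      · simp only [Set.indicator_of_mem hU, Set.indicator_of_mem (hmem.mp hU),
          A.weight_congr hUV]
      · simp only [Set.indicator_of_notMem hU, Set.indicator_of_notMem (mt hmem.mpr hU)]
    · intro U V hUV
      simp only [A.view_congr hUV]

/-! ### From integrals over visible events to conditional expectations -/

theorem integrable_freshBound (A : Adversary Ω D n) (ν : Measure Ω) [IsProbabilityMeasure ν] :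
    Integrable freshBound (A.law ν) := by
  have hm : Measurable (freshBound : Run Ω D n → ℝ) :=
    A.measurable_comap_freshBound.mono A.measurable_view.comap_le le_rfl
  refine Integrable.of_bound hm.aestronglyMeasurable 1 (ae_of_all _ fun x => ?_)
  rw [Real.norm_of_nonneg (freshBound_nonneg _)]
  exact freshBound_le_one x

theorem setIntegral_passProb_le (A : Adversary Ω D n) (ν : Measure Ω) [IsProbabilityMeasure ν]
    {q : Fin D} {s : Set (Run Ω D n)}
    (hs : MeasurableSet[MeasurableSpace.comap A.view inferInstance] s)
    (hsq : ∀ x ∈ s, A.Fresh q x) :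
    ∫ x in s, A.passProb q x ∂A.law ν ≤ ∫ x in s, freshBound x ∂A.law ν := by
  have h := A.setLIntegral_passProb_le ν hs hsq
  rw [← ofReal_integral_eq_lintegral_ofReal (A.integrable_passProb ν q).integrableOn
      (ae_of_all _ fun _ => outcomeProb_nonneg _ _ _),
    ← ofReal_integral_eq_lintegral_ofReal (A.integrable_freshBound ν).integrableOn
      (ae_of_all _ freshBound_nonneg)] at h
  exact (ENNReal.ofReal_le_ofReal_iff (integral_nonneg freshBound_nonneg)).mp h

/-- Given what the adversary knows, its expected passing probability for an outcome outside its
database is at most `freshBound`. -/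
theorem expPassGivenView_le_freshBound (A : Adversary Ω D n) (ν : Measure Ω)
    [IsProbabilityMeasure ν] (q : Fin D) :
    ∀ᵐ x ∂A.law ν, A.Fresh q x → A.expPassGivenView ν q x ≤ freshBound x := by
  have hle : MeasurableSpace.comap A.view inferInstance ≤
    (inferInstance : MeasurableSpace (Run Ω D n)) := A.measurable_view.comap_le
  have hF := A.measurableSet_comap_fresh q
  have hb := A.measurable_comap_freshBound
  have hcond : Integrable (A.expPassGivenView ν q) (A.law ν) := integrable_condExp
  have hmeas : StronglyMeasurable[MeasurableSpace.comap A.view inferInstance]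
      (A.expPassGivenView ν q) := stronglyMeasurable_condExp
  have hbi := A.integrable_freshBound ν
  -- Under the trimmed measure the comparison need only be tested on visible events, the only ones
  -- where the integral bound is available.
  have h : {x | A.Fresh q x}.indicator (A.expPassGivenView ν q) ≤ᵐ[(A.law ν).trim hle]
      {x | A.Fresh q x}.indicator freshBound := by
    refine ae_le_of_forall_setIntegral_le
      ((hcond.indicator (hle _ hF)).trim hle (hmeas.indicator hF))
      ((hbi.indicator (hle _ hF)).trim hle (hb.stronglyMeasurable.indicator hF)) ?_
    intro s hs _
    rw [← setIntegral_trim hle (hmeas.indicator hF) hs,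
      ← setIntegral_trim hle (hb.stronglyMeasurable.indicator hF) hs,
      setIntegral_indicator (hle _ hF), setIntegral_indicator (hle _ hF)]
    unfold expPassGivenView
    rw [setIntegral_condExp hle (A.integrable_passProb ν q) (hs.inter hF)]
    exact A.setIntegral_passProb_le ν (hs.inter hF) fun x hx => hx.2
  filter_upwards [ae_le_of_ae_le_trim h] with x hx hfresh
  simpa [Set.indicator, hfresh] using hx

theorem expPass_le (A : Adversary Ω D n) (ν : Measure Ω) [IsProbabilityMeasure ν] (q : Fin D)
    {c : ℝ} (hc : 0 ≤ c) (h : ∀ x, A.Fresh q x → freshBound x ≤ c) : A.expPass ν q ≤ c := by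
  have hF := A.measurableSet_comap_fresh q
  have hF' := A.measurable_view.comap_le _ hF
  rw [expPass, ProbabilityTheory.cond, integral_smul_measure, smul_eq_mul, ENNReal.toReal_inv]
  have h1 : ∫ x in {x | A.Fresh q x}, A.passProb q x ∂A.law ν ≤
      (A.law ν).real {x | A.Fresh q x} * c := by
    refine (A.setIntegral_passProb_le ν hF fun x hx => hx).trans ?_
    rw [← smul_eq_mul, ← setIntegral_const]
    exact setIntegral_mono_on (A.integrable_freshBound ν).integrableOn
      (integrable_const c).integrableOn hF' h
  -- For a null event the left side is 0, so `hc` is what covers that case.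
  exact inv_mul_le_of_le_mul₀ measureReal_nonneg hc h1

end Adversary

/-! ### Negligibility for polynomially many queries -/

/-- The bound for `D = 2 ^ k` and at most `p k` queries. -/
noncomputable def queryBound (p : Polynomial ℕ) (k : ℕ) : ℝ :=
  -- The trivial value 1 serves the finitely many k where the polynomial reaches the dimension.
  if p.eval k < 2 ^ k then 1 / ((2 : ℝ) ^ k - (p.eval k : ℕ)) else 1

theorem queryBound_nonneg (p : Polynomial ℕ) (k : ℕ) : 0 ≤ queryBound p k := by
  unfold queryBound
  split_ifs with h
  · have : ((p.eval k : ℕ) : ℝ) < 2 ^ k := by exact_mod_cast h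
    exact one_div_nonneg.mpr (by linarith)
  · exact zero_le_one

theorem freshBound_le_queryBound {Ω : Type*} {n k : ℕ} {p : Polynomial ℕ} {x : Run Ω (2 ^ k) n}
    (h : (Adversary.outcomes x.2.2).card ≤ p.eval k) :
    Adversary.freshBound x ≤ queryBound p k := by
  unfold queryBound
  split_ifs with hp
  · simpa using Adversary.freshBound_le h hp
  · exact Adversary.freshBound_le_one x

theorem isNegligible_queryBound (p : Polynomial ℕ) : IsNegligible (queryBound p) := by
  -- Eventually p(k) ≤ 2^k / 2, so the denominator is at least 2^k / 2; this gives the constant 2.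
  refine ⟨2, one_lt_two, Asymptotics.IsBigO.of_bound 2 ?_⟩
  have hlim : (fun k : ℕ => ((p.eval k : ℕ) : ℝ)) =o[Filter.atTop] fun k : ℕ => (2 : ℝ) ^ k := by
    have h1 : ∀ k : ℕ, ((p.eval k : ℕ) : ℝ)
        = ∑ i ∈ Finset.range (p.natDegree + 1), (p.coeff i : ℝ) * (k : ℝ) ^ i := by
      intro k
      rw [Polynomial.eval_eq_sum_range]
      push_cast
      rfl
    have h2 : ∀ i ∈ Finset.range (p.natDegree + 1),
        (fun k : ℕ => (p.coeff i : ℝ) * (k : ℝ) ^ i) =o[Filter.atTop] fun k : ℕ => (2 : ℝ) ^ k :=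
      fun i _ => (isLittleO_pow_const_const_pow_of_one_lt (R := ℝ) i one_lt_two).const_mul_left _
    simpa only [h1] using Asymptotics.IsLittleO.fun_sum h2
  filter_upwards [hlim.bound (show (0 : ℝ) < 1 / 2 by norm_num)] with k hk
  rw [Real.norm_of_nonneg (Nat.cast_nonneg _), Real.norm_of_nonneg (by positivity)] at hk
  have h2 : (0 : ℝ) < 2 ^ k := by positivity
  have hp : p.eval k < 2 ^ k := by
    have : ((p.eval k : ℕ) : ℝ) < 2 ^ k := by linarith
    exact_mod_cast this
  rw [Real.norm_of_nonneg (queryBound_nonneg p k), Real.norm_of_nonneg (by positivity),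
    queryBound, if_pos hp, ← div_eq_mul_inv, div_le_div_iff₀ (by linarith) h2]
  linarith

end QPUF

theorem theorem2 :
    -- the bound, for every dimension `D` and every adversary
    (∀ (D n : ℕ) (Ω : Type*) [MeasurableSpace Ω] (ν : MeasureTheory.Measure Ω)
        [MeasureTheory.IsProbabilityMeasure ν] (A : QPUF.Adversary Ω D n) (q : Fin D),
      Measurable A.view ∧
      MeasureTheory.Integrable (A.passProb q) (A.law ν) ∧
      (∀ᵐ x ∂(A.law ν), A.Fresh q x → (A.database x).ncard < D →
        A.expPassGivenView ν q x ≤ 1 / ((D : ℝ) - ((A.database x).ncard : ℝ))) ∧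
      (n < D → A.expPass ν q ≤ 1 / ((D : ℝ) - (n : ℝ)))) ∧
    -- negligibility, for `D = 2 ^ k` and polynomially many queries
    (∀ p : Polynomial ℕ, ∃ ε : ℕ → ℝ, QPUF.IsNegligible ε ∧
      ∀ (k n : ℕ) (Ω : Type*) [MeasurableSpace Ω] (ν : MeasureTheory.Measure Ω)
        [MeasureTheory.IsProbabilityMeasure ν] (A : QPUF.Adversary Ω (2 ^ k) n) (q : Fin (2 ^ k)),
      (∀ᵐ x ∂(A.law ν), A.Fresh q x → (A.database x).ncard ≤ p.eval k →
        A.expPassGivenView ν q x ≤ ε k) ∧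
      (n ≤ p.eval k → A.expPass ν q ≤ ε k)) := by
  constructor
  · intro D n Ω _ ν _ A q
    refine ⟨A.measurable_view, A.integrable_passProb ν q, ?_, fun hn => ?_⟩
    · filter_upwards [A.expPassGivenView_le_freshBound ν q] with x hx hfresh hcard
      exact (hx hfresh).trans
        (QPUF.Adversary.freshBound_le (A.card_outcomes_le_ncard x) hcard)
    · have hn' : (n : ℝ) < D := by exact_mod_cast hn
      exact A.expPass_le ν q (one_div_nonneg.mpr (by linarith)) fun x _ =>
        QPUF.Adversary.freshBound_le (QPUF.Adversary.card_outcomes_le _) hn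
  · intro p
    refine ⟨QPUF.queryBound p, QPUF.isNegligible_queryBound p, ?_⟩
    intro k n Ω _ ν _ A q
    refine ⟨?_, fun hn => ?_⟩
    · filter_upwards [A.expPassGivenView_le_freshBound ν q] with x hx hfresh hcard
      exact (hx hfresh).trans
        (QPUF.freshBound_le_queryBound ((A.card_outcomes_le_ncard x).trans hcard))
    · exact A.expPass_le ν q (QPUF.queryBound_nonneg p k) fun x _ =>
        QPUF.freshBound_le_queryBound ((QPUF.Adversary.card_outcomes_le _).trans hn)
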